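/- BIPASS is a two-player game, played under the normal-play convention (a player who cannot move loses). A strip is a non-empty finite row of black and white stones all of which are alive: every black stone has a white stone somewhere to its right and every white stone has a black stone somewhere to its left. A move on a strip interchanges a black stone with a white stone lying to its right; Left may do so only if there is no black stone between the two, Right only if there is no white stone between them. After the move, all dead stones (black stones with no white stone to their right, white stones with no black stone to their left) are removed. In a disjunctive sum the player to move moves in exactly one component. For a strip $s$ let $\Delta(s)$ be the number of its white stones minus the number of its black stones, and for a sum $g=s_1+\cdots+s_n$ let $\Delta(g)=\sum_i\Delta(s_i)$. A larva is a strip consisting of one black stone followed by at least one white stone, or of at least one black stone followed by one white stone. Outcomes of games are partially ordered by $\mathrm L>\mathrm P>\mathrm R$, $\mathrm L>\mathrm N>\mathrm R$, with $\mathrm P$ and $\mathrm N$ incomparable. Write $G\ge H$ if $o(G+X)\ge o(H+X)$ for every normal-play game $X$; $G\equiv H$ if $G\ge H$ and $H\ge G$; $G>H$ if $G\ge H$ and not $H\ge G$; $G\parallel H$ ("$G$ is fuzzy with $H$") if neither $G\ge H$ nor $H\ge G$. Let $0=\{\,\mid\,\}$, $*=\{0\mid 0\}$, ${\uparrow}=\{0\mid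 *\}$, ${\downarrow}=\{*\mid 0\}$, ${\uparrow}*={\uparrow}+*$, ${\downarrow}*={\downarrow}+*$. **Theorem.** Let $g=\sum_{i=1}^n s_i$ be a disjunctive sum of $n\ge 0$ BIPASS strips with $\Delta(g)=0$. If $n$ is odd, then 1. $g\parallel 0$; and if moreover $s_i\equiv *$ for every $i$, then $g\equiv *$; 2. ${\downarrow}*<g<{\uparrow}*$; 3. (${\downarrow}<g$ or ${\downarrow}\parallel g$) and ($g<{\uparrow}$ or $g\parallel{\uparrow}$). If $n$ is even, then 4. $g\parallel *$; and if moreover every $s_i$ is a larva, then $g\equiv 0$; 5. ${\downarrow}<g<{\uparrow}$; 6. (${\downarrow}*<g$ or ${\downarrow}*\parallel g$) and ($g<{\uparrow}*$ or $g\parallel{\uparrow}*$). -/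

import Mathlib

namespace CGT

/-- Combinatorial games: a game is given by its families of Left options and of Right options
(so every play is finite). -/
inductive Game : Type 1
  | mk (α β : Type) (L : α → Game) (R : β → Game) : Game

namespace Game

/-- `LeftWins b G`: in normal play (a player who cannot move loses) Left has a winning strategy
in `G`, where Left moves first if `b = true` and Right moves first if `b = false`. -/
def LeftWins : Bool → Game → Prop
  | true, mk _ _ L _ => ∃ i, LeftWins false (L i)
  | false, mk _ _ _ R => ∀ j, LeftWins true (R j)

/-- The outcome of a game, recorded as the pair
(Left wins moving first, Left wins moving second). The four outcomes are
`L = (True, True)`, `N = (True, False)`, `P = (False, True)`, `R = (False, False)`, and the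
product order on `Prop × Prop` is the usual partial order of outcomes:
`L > P > R`, `L > N > R`, and `P`, `N` incomparable. -/
def outcome (G : Game) : Prop × Prop := (LeftWins true G, LeftWins false G)

/-- Auxiliary to the disjunctive sum: `H ↦ G + H`, when `f i` is `H ↦ Gᴸ + H` for the `i`-th Left
option of `G` and `g j` is `H ↦ Gᴿ + H` for the `j`-th Right option of `G`. -/
def addAux {α β : Type} (f : α → Game → Game) (g : β → Game → Game) : Game → Game
  | mk α' β' L' R' =>
    mk (α ⊕ α') (β ⊕ β')
      (Sum.elim (fun i => f i (mk α' β' L' R')) (fun i => addAux f g (L' i)))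
      (Sum.elim (fun j => g j (mk α' β' L' R')) (fun j => addAux f g (R' j)))

/-- Disjunctive sum: the player to move moves in exactly one of the two components
(see `add_mk_mk` for the recursion). -/
def add : Game → Game → Game
  | mk _ _ L R => addAux (fun i => add (L i)) (fun j => add (R j))

instance : Add Game := ⟨add⟩

theorem add_mk_mk {α β α' β' : Type} (L : α → Game) (R : β → Game) (L' : α' → Game)
    (R' : β' → Game) :
    mk α β L R + mk α' β' L' R' =
      mk (α ⊕ α') (β ⊕ β')
        (Sum.elim (fun i => L i + mk α' β' L' R') (fun i => mk α β L R + L' i))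
        (Sum.elim (fun j => R j + mk α' β' L' R') (fun j => mk α β L R + R' j)) :=
  rfl

/-- The game `{ | }` without options. -/
def zero : Game := mk Empty Empty Empty.elim Empty.elim

instance : Zero Game := ⟨zero⟩

/-- The game `{G | H}` with one Left option `G` and one Right option `H`. -/
def ofOptions (G H : Game) : Game := mk Unit Unit (fun _ => G) (fun _ => H)

/-- `* = {0 | 0}` -/
def star : Game := ofOptions 0 0

/-- `↑ = {0 | *}` -/
def up : Game := ofOptions 0 star

/-- `↓ = {* | 0}` -/
def down : Game := ofOptions star 0

/-- `↑* = ↑ + *` -/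
def upStar : Game := up + star

/-- `↓* = ↓ + *` -/
def downStar : Game := down + star

/-- `G ≤ H` if `o(G + X) ≤ o(H + X)` for every game `X`. -/
instance : LE Game := ⟨fun G H => ∀ X : Game, outcome (G + X) ≤ outcome (H + X)⟩

instance : LT Game := ⟨fun G H => G ≤ H ∧ ¬ H ≤ G⟩

/-- Equality of games as values: `G ≡ H`. -/
def Equivalent (G H : Game) : Prop := G ≤ H ∧ H ≤ G

/-- `G` is fuzzy with (incomparable to) `H`. -/
def Fuzzy (G H : Game) : Prop := ¬ G ≤ H ∧ ¬ H ≤ G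

/-- `G` is less than or fuzzy with `H`. -/
def LessOrFuzzy (G H : Game) : Prop := G < H ∨ Fuzzy G H

end Game

end CGT

namespace Bipass

/-- The stones: Left plays the black ones, Right the white ones. -/
inductive Stone
  | black
  | white
  deriving DecidableEq

open Stone

/-- All stones of the row `s` are alive: every black stone has a white stone somewhere to its
right, and every white stone has a black stone somewhere to its left. -/
def AllAlive (s : List Stone) : Prop :=
  (∀ u v, s = u ++ black :: v → white ∈ v) ∧ (∀ u v, s = u ++ white :: v → black ∈ u)

/-- A strip, as a component of a sum: a non-empty row of stones all of which are alive. -/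
def IsStrip (s : List Stone) : Prop := s ≠ [] ∧ AllAlive s

/-- Removal of the dead stones: the white stones with no black stone to their left, and the black
stones with no white stone to their right. -/
def removeDead (s : List Stone) : List Stone :=
  (s.dropWhile (fun x => decide (x = white))).rdropWhile (fun x => decide (x = black))

/-- Left interchanges a black stone and a white stone to its right, with no black stone between
them; then the dead stones are removed: `LeftMove s t` says that `t` is a possible result. -/
def LeftMove (s t : List Stone) : Prop :=
  ∃ u m v, s = u ++ black :: (m ++ white :: v) ∧ black ∉ m ∧
    t = removeDead (u ++ white :: (m ++ black :: v))

/-- Right interchanges a black stone and a white stone to its right, with no white stone between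
them; then the dead stones are removed: `RightMove s t` says that `t` is a possible result. -/
def RightMove (s t : List Stone) : Prop :=
  ∃ u m v, s = u ++ black :: (m ++ white :: v) ∧ white ∉ m ∧
    t = removeDead (u ++ white :: (m ++ black :: v))

/-- The number of pairs consisting of a black stone and a white stone to its right. It drops with
every move, so that play on a strip terminates. -/
def inversions : List Stone → ℕ
  | [] => 0
  | black :: l => l.count white + inversions l
  | white :: l => inversions l

theorem inversions_append (u v : List Stone) :
    inversions (u ++ v) = inversions u + inversions v + u.count black * v.count white := by
  induction u with
  | nil => simp [inversions]
  | cons x u ih => cases x <;> (simp [inversions, ih]; try ring)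

theorem inversions_removeDead (s : List Stone) : inversions (removeDead s) = inversions s := by
  have h1 : ∀ l : List Stone,
      inversions (l.dropWhile (fun x => decide (x = white))) = inversions l := by
    intro l
    induction l with
    | nil => rfl
    | cons x l ih => cases x <;> simp [inversions, ih]
  have h2 : ∀ l : List Stone,
      inversions (l.rdropWhile (fun x => decide (x = black))) = inversions l := by
    intro l
    induction l using List.reverseRecOn with
    | nil => rfl
    | append_singleton l x ih =>
      cases x <;> simp [inversions_append, inversions, ih]
  rw [removeDead, h2, h1]

theorem inversions_swap_lt (u m v : List Stone) :
    inversions (removeDead (u ++ white :: (m ++ black :: v))) <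
      inversions (u ++ black :: (m ++ white :: v)) := by
  rw [inversions_removeDead]
  simp [inversions_append, inversions]
  ring_nf
  omega

/-- The game played on a single strip. -/
def stripGame (s : List Stone) : CGT.Game :=
  CGT.Game.mk {t // LeftMove s t} {t // RightMove s t}
    (fun t => stripGame t.1) (fun t => stripGame t.1)
termination_by inversions s
decreasing_by
  all_goals
    obtain ⟨u, m, v, rfl, -, ht⟩ := t.2
    rw [ht]
    exact inversions_swap_lt u m v

/-- The game played on several strips: the disjunctive sum of the games on the strips. -/
def sumGame (S : List (List Stone)) : CGT.Game := (S.map stripGame).sum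

/-- The excess `Δ(s)` of white stones over black stones on a strip. -/
def excess (s : List Stone) : ℤ := (s.count white : ℤ) - s.count black

/-- The excess `Δ(g)` of a sum of strips. -/
def totalExcess (S : List (List Stone)) : ℤ := (S.map excess).sum

/-- A larva: one black stone followed by at least one white stone (black headed), or at least one
black stone followed by one white stone (white headed). -/
def IsLarva (s : List Stone) : Prop :=
  ∃ k : ℕ, 1 ≤ k ∧ (s = black :: List.replicate k white ∨ s = List.replicate k black ++ [white])

end Bipass

open CGT Bipass

/-!
Left wins a sum of strips moving first if `Δ > 0`, or if `Δ = 0` and the number of strips is odd,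
and moving second if `Δ > 1`, or if `Δ = 1` and the number of strips is odd. Indeed, a move of Right
lowers `Δ` by at most one, and does not lower it at all if the strip disappears. Left raises `Δ` by
one on any strip with at least two black stones: the last of them moves past the whites to its
right and dies. Once every strip has a single black stone, the parity of `Δ` plus the number of
strips decides. For larvae there is a third way for Left to be ahead, with `Δ` one lower and an even
number of strips, because Right's moves on a surviving larva cannot keep its `Δ` unchanged.

Since `*` and `↑` are the values of the strips `●○` and `●○○`, comparing a sum with `0`, `*`, `↑` or
`↑*` amounts to adding such strips to it. Reading the strips backwards with the colours
interchanged negates the values, which gives the bounds on the other side.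
-/

namespace CGT.Game

/-! ### Games form a partially ordered abelian group -/

/-- `IsOption p G K` says that `K` is an option of `G` for the player `p`, where `true` stands for
Left and `false` for Right, as in `LeftWins`. -/
def IsOption : Bool → Game → Game → Prop
  | true, mk _ _ L _, K => ∃ i, L i = K
  | false, mk _ _ _ R, K => ∃ j, R j = K

variable {p b c : Bool} {G H K X : Game}

theorem leftWins_true_iff : LeftWins true G ↔ ∃ K, IsOption true G K ∧ LeftWins false K := by
  cases G with
  | mk α β L R => simp [LeftWins, IsOption]

theorem leftWins_false_iff : LeftWins false G ↔ ∀ K, IsOption false G K → LeftWins true K := by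
  cases G with
  | mk α β L R => simp [LeftWins, IsOption]

theorem not_isOption_zero : ¬ IsOption p 0 K := by
  cases p <;> exact fun ⟨i, _⟩ => i.elim

theorem isOption_ofOptions : IsOption p (ofOptions G H) K ↔ (if p then G else H) = K := by
  cases p <;> simp [ofOptions, IsOption]

theorem isOption_add :
    IsOption p (G + H) K ↔
      (∃ G', IsOption p G G' ∧ G' + H = K) ∨ ∃ H', IsOption p H H' ∧ G + H' = K := by
  cases G with
  | mk α β L R =>
    cases H with
    | mk α' β' L' R' => cases p <;> simp [add_mk_mk, IsOption]

theorem IsOption.add_right (h : IsOption p G K) (X : Game) : IsOption p (G + X) (K + X) :=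
  isOption_add.2 (.inl ⟨K, h, rfl⟩)

theorem IsOption.add_left (h : IsOption p G K) (X : Game) : IsOption p (X + G) (X + K) :=
  isOption_add.2 (.inr ⟨K, h, rfl⟩)

@[elab_as_elim]
theorem option_induction {P : Game → Prop} (G : Game)
    (h : ∀ G, (∀ p K, IsOption p G K → P K) → P G) : P G := by
  induction G with
  | mk α β L R ihL ihR =>
    refine h _ fun p K hK => ?_
    cases p
    · obtain ⟨j, rfl⟩ := hK
      exact ihR j
    · obtain ⟨i, rfl⟩ := hK
      exact ihL i

instance : Preorder Game where
  le_refl _ _ := le_rfl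
  le_trans _ _ _ h₁ h₂ X := (h₁ X).trans (h₂ X)
  lt_iff_le_not_ge _ _ := Iff.rfl

/-- A relation between games under which the options of related games for each player can be
matched by related options. Related games then have equal values, which settles the structural
identities of games without an induction for each of them. -/
structure IsBisimulation (r : Game → Game → Prop) : Prop where
  forth : ∀ {G H p G'}, r G H → IsOption p G G' → ∃ H', IsOption p H H' ∧ r G' H'
  back : ∀ {G H p H'}, r G H → IsOption p H H' → ∃ G', IsOption p G G' ∧ r G' H'

namespace IsBisimulation

variable {r : Game → Game → Prop}

theorem leftWins_iff (hr : IsBisimulation r) (h : r G H) : LeftWins b G ↔ LeftWins b H := by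
  induction G using option_induction generalizing H b with
  | h G ih =>
    cases b
    · rw [leftWins_false_iff, leftWins_false_iff]
      constructor
      · intro hG H' hH'
        obtain ⟨G', hG', h'⟩ := hr.back h hH'
        exact (ih _ _ hG' h').1 (hG G' hG')
      · intro hH G' hG'
        obtain ⟨H', hH', h'⟩ := hr.forth h hG'
        exact (ih _ _ hG' h').2 (hH H' hH')
    · rw [leftWins_true_iff, leftWins_true_iff]
      constructor
      · rintro ⟨G', hG', hw⟩
        obtain ⟨H', hH', h'⟩ := hr.forth h hG'
        exact ⟨H', hH', (ih _ _ hG' h').1 hw⟩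
      · rintro ⟨H', hH', hw⟩
        obtain ⟨G', hG', h'⟩ := hr.back h hH'
        exact ⟨G', hG', (ih _ _ hG' h').2 hw⟩

theorem add_right (hr : IsBisimulation r) :
    IsBisimulation fun A B => ∃ G H X, r G H ∧ G + X = A ∧ H + X = B := by
  constructor
  · rintro _ _ p _ ⟨G, H, X, h, rfl, rfl⟩ hA
    obtain ⟨G', hG', rfl⟩ | ⟨X', hX', rfl⟩ := isOption_add.1 hA
    · obtain ⟨H', hH', h'⟩ := hr.forth h hG'
      exact ⟨_, hH'.add_right X, G', H', X, h', rfl, rfl⟩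
    · exact ⟨_, hX'.add_left H, G, H, X', h, rfl, rfl⟩
  · rintro _ _ p _ ⟨G, H, X, h, rfl, rfl⟩ hB
    obtain ⟨H', hH', rfl⟩ | ⟨X', hX', rfl⟩ := isOption_add.1 hB
    · obtain ⟨G', hG', h'⟩ := hr.back h hH'
      exact ⟨_, hG'.add_right X, G', H', X, h', rfl, rfl⟩
    · exact ⟨_, hX'.add_left G, G, H, X', h, rfl, rfl⟩

theorem equivalent (hr : IsBisimulation r) (h : r G H) : Equivalent G H := by
  have key (X : Game) (b : Bool) : LeftWins b (G + X) ↔ LeftWins b (H + X) :=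
    hr.add_right.leftWins_iff ⟨G, H, X, h, rfl, rfl⟩
  exact ⟨fun X => ⟨(key X true).1, (key X false).1⟩, fun X => ⟨(key X true).2, (key X false).2⟩⟩

end IsBisimulation

theorem isBisimulation_add_zero : IsBisimulation fun A G => G + 0 = A := by
  constructor
  · rintro _ G p _ rfl hA
    obtain ⟨G', hG', rfl⟩ | ⟨K, hK, rfl⟩ := isOption_add.1 hA
    · exact ⟨G', hG', rfl⟩
    · exact absurd hK not_isOption_zero
  · rintro _ G p G' rfl hG'
    exact ⟨_, hG'.add_right 0, rfl⟩

theorem add_comm_equivalent (G H : Game) : Equivalent (G + H) (H + G) := by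
  have hr : IsBisimulation fun A B => ∃ G H : Game, G + H = A ∧ H + G = B := by
    constructor
    · rintro _ _ p _ ⟨G, H, rfl, rfl⟩ hA
      obtain ⟨G', hG', rfl⟩ | ⟨H', hH', rfl⟩ := isOption_add.1 hA
      · exact ⟨_, hG'.add_left H, G', H, rfl, rfl⟩
      · exact ⟨_, hH'.add_right G, G, H', rfl, rfl⟩
    · rintro _ _ p _ ⟨G, H, rfl, rfl⟩ hB
      obtain ⟨H', hH', rfl⟩ | ⟨G', hG', rfl⟩ := isOption_add.1 hB
      · exact ⟨_, hH'.add_left G, G, H', rfl, rfl⟩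
      · exact ⟨_, hG'.add_right H, G', H, rfl, rfl⟩
  exact hr.equivalent ⟨G, H, rfl, rfl⟩

theorem add_assoc_equivalent (G H X : Game) :
    Equivalent (G + H + X) (G + (H + X)) := by
  have hr : IsBisimulation fun A B => ∃ G H X : Game, G + H + X = A ∧ G + (H + X) = B := by
    constructor
    · rintro _ _ p _ ⟨G, H, X, rfl, rfl⟩ hA
      obtain ⟨K, hK, rfl⟩ | ⟨X', hX', rfl⟩ := isOption_add.1 hA
      · obtain ⟨G', hG', rfl⟩ | ⟨H', hH', rfl⟩ := isOption_add.1 hK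
        · exact ⟨_, hG'.add_right (H + X), G', H, X, rfl, rfl⟩
        · exact ⟨_, (hH'.add_right X).add_left G, G, H', X, rfl, rfl⟩
      · exact ⟨_, (hX'.add_left H).add_left G, G, H, X', rfl, rfl⟩
    · rintro _ _ p _ ⟨G, H, X, rfl, rfl⟩ hB
      obtain ⟨G', hG', rfl⟩ | ⟨K, hK, rfl⟩ := isOption_add.1 hB
      · exact ⟨_, (hG'.add_right H).add_right X, G', H, X, rfl, rfl⟩
      · obtain ⟨H', hH', rfl⟩ | ⟨X', hX', rfl⟩ := isOption_add.1 hK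
        · exact ⟨_, (hH'.add_left G).add_right X, G, H', X, rfl, rfl⟩
        · exact ⟨_, hX'.add_left (G + H), G, H, X', rfl, rfl⟩
  exact hr.equivalent ⟨G, H, X, rfl, rfl⟩

theorem le_of_forall_leftWins (h : ∀ X b, LeftWins b (G + X) → LeftWins b (H + X)) : G ≤ H :=
  fun X => ⟨h X true, h X false⟩

theorem leftWins_add_mono (h : G ≤ H) (hw : LeftWins b (G + X)) : LeftWins b (H + X) := by
  cases b
  · exact (h X).2 hw
  · exact (h X).1 hw

theorem leftWins_mono (h : G ≤ H) (hw : LeftWins b G) : LeftWins b H :=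
  (isBisimulation_add_zero.leftWins_iff rfl).1
    (leftWins_add_mono h ((isBisimulation_add_zero.leftWins_iff rfl).2 hw))

theorem add_le_add_of_le_left (h : G ≤ H) (X : Game) : G + X ≤ H + X :=
  le_of_forall_leftWins fun Y _ hw =>
    leftWins_mono (add_assoc_equivalent H X Y).2
      (leftWins_add_mono h (leftWins_mono (add_assoc_equivalent G X Y).1 hw))

protected theorem add_le_add (hGH : G ≤ H) (hKX : K ≤ X) : G + K ≤ H + X :=
  calc
    G + K ≤ H + K := add_le_add_of_le_left hGH K
    _ ≤ K + H := (add_comm_equivalent H K).1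
    _ ≤ X + H := add_le_add_of_le_left hKX H
    _ ≤ H + X := (add_comm_equivalent X H).1

/-- Left answers every move in the component in which it was made. -/
theorem leftWins_or_add (hbc : (b && c) = false) (hG : LeftWins b G) (hH : LeftWins c H) :
    LeftWins (b || c) (G + H) := by
  induction G using option_induction generalizing b c H with
  | h G ihG =>
    induction H using option_induction generalizing b c with
    | h H ihH =>
      cases b <;> cases c
      · refine leftWins_false_iff.2 fun K hK => ?_
        obtain ⟨G', hG', rfl⟩ | ⟨H', hH', rfl⟩ := isOption_add.1 hK
        · exact ihG _ _ hG' (b := true) (c := false) rfl (leftWins_false_iff.1 hG _ hG') hH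
        · exact ihH _ _ hH' (b := false) (c := true) rfl hG (leftWins_false_iff.1 hH _ hH')
      · obtain ⟨H', hH', hw⟩ := leftWins_true_iff.1 hH
        exact leftWins_true_iff.2 ⟨_, hH'.add_left G, ihH _ _ hH' (b := false) rfl hG hw⟩
      · obtain ⟨G', hG', hw⟩ := leftWins_true_iff.1 hG
        exact leftWins_true_iff.2 ⟨_, hG'.add_right H, ihG _ _ hG' (b := false) rfl hw hH⟩
      · cases hbc

theorem zero_le_iff_leftWins_false : 0 ≤ G ↔ LeftWins false G := by
  constructor
  · exact fun h => leftWins_mono h (leftWins_false_iff.2 fun _ hK => absurd hK not_isOption_zero)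
  · refine fun h => le_of_forall_leftWins fun X b hw => ?_
    have hX : LeftWins b X :=
      (isBisimulation_add_zero.leftWins_iff rfl).1 (leftWins_mono (add_comm_equivalent 0 X).1 hw)
    exact leftWins_or_add (b := false) rfl h hX

/-- The game with the roles of the players interchanged. -/
def neg : Game → Game
  | mk α β L R => mk β α (fun j => neg (R j)) (fun i => neg (L i))

instance : Neg Game := ⟨neg⟩

theorem neg_mk {α β : Type} (L : α → Game) (R : β → Game) :
    -mk α β L R = mk β α (fun j => -R j) (fun i => -L i) := rfl

instance : InvolutiveNeg Game where
  neg_neg G := by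
    induction G with
    | mk α β L R ihL ihR => simp only [neg_mk, ihL, ihR]

protected theorem neg_zero : -(0 : Game) = 0 :=
  congrArg₂ (mk Empty Empty) (funext fun i => i.elim) (funext fun j => j.elim)

protected theorem neg_add (G H : Game) : -(G + H) = -G + -H := by
  induction G generalizing H with
  | mk α β L R ihL ihR =>
    induction H with
    | mk α' β' L' R' jhL jhR =>
      rw [add_mk_mk, neg_mk]
      exact congrArg₂ (mk _ _)
        (funext <| Sum.rec (fun j => ihR j _) jhR) (funext <| Sum.rec (fun i => ihL i _) jhL)

theorem neg_ofOptions (G H : Game) : -ofOptions G H = ofOptions (-H) (-G) := rfl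

theorem neg_star : -star = star := by rw [star, neg_ofOptions, Game.neg_zero]

theorem neg_up : -up = down := by rw [up, neg_ofOptions, Game.neg_zero, neg_star, down]

theorem neg_upStar : -upStar = downStar := by
  rw [upStar, Game.neg_add, neg_up, neg_star, downStar]

theorem isOption_neg : IsOption p (-G) K ↔ ∃ K', IsOption (!p) G K' ∧ -K' = K := by
  cases G with
  | mk α β L R => cases p <;> simp [neg_mk, IsOption]

theorem IsOption.neg (h : IsOption p G K) : IsOption (!p) (-G) (-K) :=
  isOption_neg.2 ⟨K, by rwa [Bool.not_not], rfl⟩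

theorem leftWins_neg : LeftWins b (-G) ↔ ¬ LeftWins (!b) G := by
  induction G generalizing b with
  | mk α β L R ihL ihR => cases b <;> simp [neg_mk, LeftWins, ihL, ihR]

theorem neg_le_neg_of_le (h : G ≤ H) : -H ≤ -G := by
  refine le_of_forall_leftWins fun X b hw => ?_
  have key (K : Game) : LeftWins b (-K + X) ↔ ¬ LeftWins (!b) (K + -X) := by
    rw [← leftWins_neg, Game.neg_add, neg_neg]
  exact (key G).2 fun hG => (key H).1 hw (leftWins_add_mono h hG)

theorem not_le_zero_iff_leftWins_true : ¬ G ≤ 0 ↔ LeftWins true G := by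
  have h : G ≤ 0 ↔ 0 ≤ -G :=
    ⟨fun h => by simpa only [Game.neg_zero] using neg_le_neg_of_le h,
      fun h => by simpa only [Game.neg_zero, neg_neg] using neg_le_neg_of_le h⟩
  rw [h, zero_le_iff_leftWins_false, leftWins_neg, Bool.not_false, not_not]

/-- Left mirrors every move in the other component. -/
theorem leftWins_false_add_neg (G : Game) : LeftWins false (G + -G) := by
  induction G using option_induction with
  | h G ih =>
    refine leftWins_false_iff.2 fun K hK => leftWins_true_iff.2 ?_
    obtain ⟨G', hG', rfl⟩ | ⟨_, hK', rfl⟩ := isOption_add.1 hK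
    · exact ⟨_, hG'.neg.add_left G', ih _ _ hG'⟩
    · obtain ⟨G', hG', rfl⟩ := isOption_neg.1 hK'
      exact ⟨_, hG'.add_right (-G'), ih _ _ hG'⟩

theorem add_neg_equivalent (G : Game) : Equivalent (G + -G) 0 := by
  have h (G : Game) : 0 ≤ G + -G := zero_le_iff_leftWins_false.2 (leftWins_false_add_neg G)
  refine ⟨?_, h G⟩
  simpa only [Game.neg_add, Game.neg_zero, neg_neg] using neg_le_neg_of_le (h (-G))

/-- The group of values of games, that is, of games modulo `Game.Equivalent`. -/
abbrev Value : Type 1 := Antisymmetrization Game (· ≤ ·)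

/-- The value of a game. -/
def value (G : Game) : Value := toAntisymmetrization (· ≤ ·) G

theorem value_le_value : value G ≤ value H ↔ G ≤ H :=
  toAntisymmetrization_le_toAntisymmetrization_iff

theorem value_lt_value : value G < value H ↔ G < H :=
  toAntisymmetrization_lt_toAntisymmetrization_iff

theorem value_eq_value : value G = value H ↔ Equivalent G H := Quotient.eq

instance : Zero Value := ⟨value 0⟩

instance : Neg Value :=
  ⟨Quotient.map (- ·) fun _ _ h => ⟨neg_le_neg_of_le h.2, neg_le_neg_of_le h.1⟩⟩

instance : Add Value :=
  ⟨Quotient.map₂ (· + ·) fun _ _ h _ _ h' => ⟨Game.add_le_add h.1 h'.1, Game.add_le_add h.2 h'.2⟩⟩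

theorem value_zero : value 0 = 0 := rfl

theorem value_neg (G : Game) : value (-G) = -value G := rfl

theorem value_add (G H : Game) : value (G + H) = value G + value H := rfl

instance : AddCommGroup Value where
  add_assoc := by
    rintro ⟨G⟩ ⟨H⟩ ⟨X⟩
    exact value_eq_value.2 (add_assoc_equivalent G H X)
  add_comm := by
    rintro ⟨G⟩ ⟨H⟩
    exact value_eq_value.2 (add_comm_equivalent G H)
  zero_add := by
    rintro ⟨G⟩
    exact (value_eq_value.2 (add_comm_equivalent 0 G)).trans
      (value_eq_value.2 (isBisimulation_add_zero.equivalent rfl))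
  add_zero := by
    rintro ⟨G⟩
    exact value_eq_value.2 (isBisimulation_add_zero.equivalent rfl)
  neg_add_cancel := by
    rintro ⟨G⟩
    exact (value_eq_value.2 (add_comm_equivalent (-G) G)).trans
      (value_eq_value.2 (add_neg_equivalent G))
  nsmul := nsmulRec
  zsmul := zsmulRec

instance : IsOrderedAddMonoid Value where
  add_le_add_left := by
    rintro ⟨G⟩ ⟨H⟩ h ⟨X⟩
    exact value_le_value.2 (add_le_add_of_le_left (value_le_value.1 h) X)

theorem le_iff_forall_not_le :
    G ≤ H ↔ (∀ K, IsOption true G K → ¬ H ≤ K) ∧ ∀ K, IsOption false H K → ¬ K ≤ G := by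
  have not_le_iff (A B : Game) : ¬ A ≤ B ↔ LeftWins true (A + -B) := by
    rw [← not_le_zero_iff_leftWins_true, ← value_le_value, ← value_le_value, value_add, value_neg,
      value_zero, ← sub_eq_add_neg, sub_nonpos]
  have le_iff : G ≤ H ↔ LeftWins false (H + -G) := by
    rw [← zero_le_iff_leftWins_false, ← value_le_value, ← value_le_value, value_add, value_neg,
      value_zero, ← sub_eq_add_neg, sub_nonneg]
  rw [le_iff, leftWins_false_iff]
  simp only [not_le_iff]
  constructor
  · exact fun h => ⟨fun K hK => h _ (hK.neg.add_left H), fun K hK => h _ (hK.add_right (-G))⟩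
  · rintro ⟨hG, hH⟩ _ hsum
    obtain ⟨K, hK, rfl⟩ | ⟨_, hK', rfl⟩ := isOption_add.1 hsum
    · exact hH K hK
    · obtain ⟨K, hK, rfl⟩ := isOption_neg.1 hK'
      exact hG K hK

theorem IsOption.not_le (h : IsOption true G K) : ¬ G ≤ K :=
  fun hGK => (le_iff_forall_not_le.1 le_rfl).1 K h hGK

theorem IsOption.not_ge (h : IsOption false G K) : ¬ K ≤ G :=
  fun hKG => (le_iff_forall_not_le.1 le_rfl).2 K h hKG

theorem le_of_forall_option_le
    (hG : ∀ K, IsOption true G K → ∃ K', IsOption true H K' ∧ K ≤ K')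
    (hH : ∀ K, IsOption false H K → ∃ K', IsOption false G K' ∧ K' ≤ K) : G ≤ H := by
  refine le_iff_forall_not_le.2 ⟨fun K hK hHK => ?_, fun K hK hKG => ?_⟩
  · obtain ⟨K', hK', hKK'⟩ := hG K hK
    exact hK'.not_le (hHK.trans hKK')
  · obtain ⟨K', hK', hKK'⟩ := hH K hK
    exact hK'.not_ge (hKK'.trans hKG)

theorem value_star_add_value_star : value star + value star = 0 := by
  rw [add_eq_zero_iff_eq_neg, ← value_neg, neg_star]

theorem lessOrFuzzy_iff : LessOrFuzzy G H ↔ ¬ H ≤ G := by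
  unfold LessOrFuzzy Fuzzy
  rw [lt_iff_le_not_ge]
  tauto

end CGT.Game

namespace Bipass

open Stone CGT.Game

/-! ### Moves on strips -/

variable {p : Bool} {s t u v : List Stone}

/-- The colour of the stones of the player `p`, where `true` stands for Left. -/
def Stone.ofPlayer : Bool → Stone
  | true => black
  | false => white

/-- `LeftMove` for `p = true` and `RightMove` for `p = false`. -/
def Move (p : Bool) (s t : List Stone) : Prop :=
  ∃ u m v, s = u ++ black :: (m ++ white :: v) ∧ ofPlayer p ∉ m ∧
    t = removeDead (u ++ white :: (m ++ black :: v))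

theorem isOption_stripGame {K : Game} :
    IsOption p (stripGame s) K ↔ ∃ t, Move p s t ∧ stripGame t = K := by
  rw [stripGame]
  cases p <;> simp only [IsOption, Subtype.exists, exists_prop] <;> rfl

theorem isOption_sumGame {S : List (List Stone)} {K : Game} :
    IsOption p (sumGame S) K ↔
      ∃ A s B t, S = A ++ s :: B ∧ Move p s t ∧ sumGame (A ++ t :: B) = K := by
  have sumGame_cons (s : List Stone) (S : List (List Stone)) :
      sumGame (s :: S) = stripGame s + sumGame S := rfl
  induction S generalizing K with
  | nil => exact iff_of_false not_isOption_zero (by simp)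
  | cons s S ih =>
    rw [sumGame_cons, isOption_add]
    constructor
    · rintro (⟨_, hs, rfl⟩ | ⟨_, hS, rfl⟩)
      · obtain ⟨t, ht, rfl⟩ := isOption_stripGame.1 hs
        exact ⟨[], s, S, t, rfl, ht, rfl⟩
      · obtain ⟨A, r, B, t, rfl, ht, rfl⟩ := ih.1 hS
        exact ⟨s :: A, r, B, t, rfl, ht, rfl⟩
    · rintro ⟨_ | ⟨a, A⟩, r, B, t, hsplit, ht, rfl⟩ <;> obtain ⟨rfl, rfl⟩ := List.cons.inj hsplit
      · exact .inl ⟨_, isOption_stripGame.2 ⟨t, ht, rfl⟩, rfl⟩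
      · exact .inr ⟨_, ih.2 ⟨A, r, B, t, rfl, ht, rfl⟩, rfl⟩

theorem AllAlive.black_mem_of_append (h : AllAlive (u ++ v)) (hu : u ≠ []) : black ∈ u := by
  obtain ⟨_ | _, u, rfl⟩ := List.exists_cons_of_ne_nil hu
  · exact List.mem_cons_self
  · exact absurd (h.2 [] (u ++ v) rfl) List.not_mem_nil

theorem AllAlive.white_mem_of_append (h : AllAlive (u ++ v)) (hv : v ≠ []) : white ∈ v := by
  obtain ⟨v, _ | _, rfl⟩ := (List.eq_nil_or_concat v).resolve_left hv
  · exact absurd (h.1 (u ++ v) [] (by simp)) List.not_mem_nil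
  · simp

theorem allAlive_nil : AllAlive [] := by
  constructor <;> simp

theorem allAlive_black_cons_append_white (m : List Stone) :
    AllAlive (black :: (m ++ [white])) := by
  constructor
  · intro u v h
    have hlast : (black :: v).getLast? = some white := by
      rw [← List.getLast?_append_cons u, ← h, ← List.cons_append, List.getLast?_concat]
    simpa using List.mem_of_getLast? hlast
  · rintro (_ | ⟨x, u⟩) v h <;> obtain ⟨hx, -⟩ := List.cons.inj h
    · cases hx
    · exact hx ▸ List.mem_cons_self

theorem AllAlive.eq_nil_or_eq (h : AllAlive s) : s = [] ∨ ∃ m, s = black :: (m ++ [white]) := by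
  rcases s with _ | ⟨_ | _, r⟩
  · exact .inl rfl
  · obtain rfl | ⟨m, _ | _, rfl⟩ := List.eq_nil_or_concat r
    · exact absurd (h.1 [] [] rfl) List.not_mem_nil
    · exact absurd (h.1 (black :: m) [] (by simp)) List.not_mem_nil
    · exact .inr ⟨m, by simp⟩
  · exact absurd (h.2 [] r rfl) List.not_mem_nil

@[elab_as_elim]
theorem row_induction {P : List Stone → Prop} (s : List Stone)
    (alive : ∀ s, AllAlive s → P s) (white_cons : ∀ s, P s → P (white :: s))
    (append_black : ∀ s, P s → P (s ++ [black])) : P s := by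
  induction s with
  | nil => exact alive [] allAlive_nil
  | cons x s ih =>
    cases x
    · clear ih
      induction s using List.reverseRecOn with
      | nil => exact append_black [] (alive [] allAlive_nil)
      | append_singleton s x ih =>
        cases x
        · exact append_black (black :: s) ih
        · exact alive _ (allAlive_black_cons_append_white s)
    · exact white_cons s ih

theorem removeDead_of_allAlive (h : AllAlive s) : removeDead s = s := by
  obtain rfl | ⟨m, rfl⟩ := h.eq_nil_or_eq
  · rfl
  · exact List.rdropWhile_concat_neg (fun x => decide (x = black)) (black :: m) white (by simp)

theorem removeDead_white_cons (s : List Stone) : removeDead (white :: s) = removeDead s := by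
  simp [removeDead]

theorem removeDead_append_black (s : List Stone) : removeDead (s ++ [black]) = removeDead s := by
  rw [removeDead, removeDead, List.dropWhile_append]
  split_ifs with h
  · rw [List.isEmpty_iff.1 h]
    rfl
  · exact List.rdropWhile_concat_pos _ _ _ (by simp)

theorem allAlive_removeDead (s : List Stone) : AllAlive (removeDead s) := by
  induction s using row_induction with
  | alive s hs => rwa [removeDead_of_allAlive hs]
  | white_cons s ih => rwa [removeDead_white_cons]
  | append_black s ih => rwa [removeDead_append_black]

theorem removeDead_sublist (s : List Stone) : (removeDead s).Sublist s :=
  (List.rdropWhile_prefix _ _).sublist.trans (List.dropWhile_suffix _).sublist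

theorem Move.allAlive (h : Move p s t) : AllAlive t := by
  obtain ⟨u, m, v, -, -, rfl⟩ := h
  exact allAlive_removeDead _

theorem Move.count_le (h : Move p s t) (x : Stone) : t.count x ≤ s.count x := by
  obtain ⟨u, m, v, rfl, -, rfl⟩ := h
  calc
    _ ≤ (u ++ white :: (m ++ black :: v)).count x := (removeDead_sublist _).count_le x
    _ = _ := by simp only [List.count_append, List.count_cons]; omega

theorem Move.inversions_lt (h : Move p s t) : inversions t < inversions s := by
  obtain ⟨u, m, v, rfl, -, rfl⟩ := h
  exact inversions_swap_lt u m v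

theorem Move.eq_black_cons_append_white (hs : AllAlive s) (h : Move p s []) :
    ∃ m, ofPlayer p ∉ m ∧ s = black :: (m ++ [white]) := by
  obtain ⟨u, m, v, rfl, hm, hnil⟩ := h
  have hinv : inversions (u ++ white :: (m ++ black :: v)) = 0 := by
    rw [← inversions_removeDead, ← hnil]
    rfl
  simp only [inversions_append, inversions, Nat.add_eq_zero_iff, mul_eq_zero] at hinv
  have hu : black ∉ u := List.count_eq_zero.1 (by simpa using hinv.2)
  have hv : white ∉ v := List.count_eq_zero.1 hinv.1.2.1.2.1
  obtain rfl : u = [] := by_contra fun h => hu (hs.black_mem_of_append h)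
  obtain rfl : v = [] := by
    have hs' : AllAlive ((black :: (m ++ [white])) ++ v) := by simpa using hs
    exact by_contra fun h => hv (hs'.white_mem_of_append h)
  exact ⟨m, hm, rfl⟩

/-! ### Exchanging the players -/

/-- The other colour. -/
def Stone.swap : Stone → Stone
  | black => white
  | white => black

/-- The row read from right to left with the colours interchanged, on which the players have
exchanged their roles. -/
def mirror (s : List Stone) : List Stone := (s.map Stone.swap).reverse

theorem mirror_mirror (s : List Stone) : mirror (mirror s) = s := by
  have h : Stone.swap ∘ Stone.swap = id := by
    funext x
    cases x <;> rfl
  simp [mirror, List.map_reverse, h]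

theorem mirror_append (s t : List Stone) : mirror (s ++ t) = mirror t ++ mirror s := by
  simp [mirror]

theorem mirror_black_cons (s : List Stone) : mirror (black :: s) = mirror s ++ [white] := by
  simp [mirror, Stone.swap]

theorem mirror_white_cons (s : List Stone) : mirror (white :: s) = mirror s ++ [black] := by
  simp [mirror, Stone.swap]

theorem AllAlive.mirror (h : AllAlive s) : AllAlive (mirror s) := by
  obtain rfl | ⟨m, rfl⟩ := h.eq_nil_or_eq
  · exact allAlive_nil
  · rw [mirror_black_cons, mirror_append]
    exact allAlive_black_cons_append_white (Bipass.mirror m)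

theorem removeDead_mirror (s : List Stone) : removeDead (mirror s) = mirror (removeDead s) := by
  induction s using row_induction with
  | alive s hs => rw [removeDead_of_allAlive hs, removeDead_of_allAlive hs.mirror]
  | white_cons s ih => rw [removeDead_white_cons, mirror_white_cons, removeDead_append_black, ih]
  | append_black s ih =>
    rw [removeDead_append_black, mirror_append]
    exact (removeDead_white_cons _).trans ih

theorem Stone.swap_injective : Function.Injective Stone.swap := by
  rintro (_ | _) (_ | _) <;> simp [Stone.swap]

theorem count_swap_mirror (s : List Stone) (x : Stone) :
    (mirror s).count x.swap = s.count x := by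
  rw [mirror, List.count_reverse, List.count_map_of_injective _ _ swap_injective]

theorem swap_mem_mirror {x : Stone} : x.swap ∈ mirror s ↔ x ∈ s := by
  rw [mirror, List.mem_reverse, List.mem_map_of_injective swap_injective]

theorem Move.mirror (h : Move p s t) : Move (!p) (mirror s) (mirror t) := by
  obtain ⟨u, m, v, rfl, hm, rfl⟩ := h
  refine ⟨Bipass.mirror v, Bipass.mirror m, Bipass.mirror u, ?_, ?_, ?_⟩
  · simp [mirror_append, mirror_black_cons, mirror_white_cons]
  · have hp : ofPlayer (!p) = (ofPlayer p).swap := by cases p <;> rfl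
    rwa [hp, swap_mem_mirror]
  · rw [← removeDead_mirror]
    simp [mirror_append, mirror_black_cons, mirror_white_cons]

theorem value_stripGame_mirror (s : List Stone) :
    value (stripGame (mirror s)) = -value (stripGame s) := by
  have hr : IsBisimulation fun A B => ∃ s, stripGame (mirror s) = A ∧ -stripGame s = B := by
    constructor
    · rintro _ _ p _ ⟨s, rfl, rfl⟩ hA
      obtain ⟨t, ht, rfl⟩ := isOption_stripGame.1 hA
      have hst : Move (!p) s (mirror t) := by simpa only [mirror_mirror] using ht.mirror
      exact ⟨_, isOption_neg.2 ⟨_, isOption_stripGame.2 ⟨_, hst, rfl⟩, rfl⟩, mirror t,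
        by rw [mirror_mirror], rfl⟩
    · rintro _ _ p _ ⟨s, rfl, rfl⟩ hB
      obtain ⟨_, hs, rfl⟩ := isOption_neg.1 hB
      obtain ⟨t, ht, rfl⟩ := isOption_stripGame.1 hs
      exact ⟨_, isOption_stripGame.2 ⟨_, by simpa using ht.mirror, rfl⟩, t, rfl, rfl⟩
  exact value_eq_value.2 (hr.equivalent ⟨s, rfl, rfl⟩)

/-! ### How moves change the excess -/

theorem excess_nil : excess [] = 0 := rfl

theorem excess_append (s t : List Stone) : excess (s ++ t) = excess s + excess t := by
  simp only [excess, List.count_append, Nat.cast_add]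
  ring

theorem excess_black_cons (s : List Stone) : excess (black :: s) = excess s - 1 := by
  rw [← List.singleton_append, excess_append, show excess [black] = -1 from rfl]
  ring

theorem excess_white_cons (s : List Stone) : excess (white :: s) = excess s + 1 := by
  rw [← List.singleton_append, excess_append, show excess [white] = 1 from rfl]
  ring

theorem excess_mirror (s : List Stone) : excess (mirror s) = -excess s := by
  have hwhite : (mirror s).count white = s.count black := count_swap_mirror s black
  have hblack : (mirror s).count black = s.count white := count_swap_mirror s white
  rw [excess, excess, hwhite, hblack, neg_sub]

theorem excess_nonneg_of_count_black_le_one (hs : AllAlive s) (h : s.count black ≤ 1) :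
    0 ≤ excess s := by
  obtain rfl | ⟨m, rfl⟩ := hs.eq_nil_or_eq
  · rfl
  · rw [excess, sub_nonneg, Nat.cast_le]
    exact h.trans (List.count_pos_iff.2 (by simp))

theorem excess_le_excess_removeDead (h : s.head? ≠ some white) :
    excess s ≤ excess (removeDead s) := by
  induction s using row_induction with
  | alive s hs => rw [removeDead_of_allAlive hs]
  | white_cons s _ => simp at h
  | append_black s ih =>
    have hs : s.head? ≠ some white := fun hs => h (by simp [hs])
    rw [removeDead_append_black, excess_append, excess_black_cons, excess_nil]
    linarith [ih hs]

theorem excess_sub_one_le_of_move_false (hs : AllAlive s) (h : Move false s t) :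
    excess s - 1 ≤ excess t := by
  obtain ⟨u, m, v, rfl, hm, rfl⟩ := h
  rcases u with _ | ⟨_ | _, u⟩
  · have hm' : (m ++ black :: v).head? ≠ some white := by
      rcases m with _ | ⟨_ | _, m⟩ <;> simp_all [ofPlayer]
    have hle := excess_le_excess_removeDead hm'
    simp only [List.nil_append, removeDead_white_cons, excess_append, excess_black_cons,
      excess_white_cons] at hle ⊢
    linarith
  · have hle := excess_le_excess_removeDead
      (s := black :: u ++ white :: (m ++ black :: v)) (by simp)
    simp only [excess_append, excess_black_cons, excess_white_cons] at hle ⊢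
    linarith
  · exact absurd (hs.2 [] _ rfl) List.not_mem_nil

theorem excess_nonpos_of_move_false_nil (hs : AllAlive s) (h : Move false s []) :
    excess s ≤ 0 := by
  obtain ⟨m, hm, rfl⟩ := h.eq_black_cons_append_white hs
  simp [excess, List.count_eq_zero.2 (show white ∉ m from hm)]

theorem eq_replicate_white_of_black_notMem (h : black ∉ s) :
    s = List.replicate s.length white := by
  refine List.eq_replicate_of_mem ?_
  rintro (_ | _) hx
  · exact absurd hx h
  · rfl

theorem exists_move_true_of_two_le_count_black (hs : AllAlive s) (h : 2 ≤ s.count black) :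
    ∃ t, Move true s t ∧ t ≠ [] ∧ excess t = excess s + 1 := by
  obtain rfl | ⟨m, rfl⟩ := hs.eq_nil_or_eq
  · simp at h
  have hm : black ∈ m.reverse := by
    simp only [List.count_cons_self, List.count_append, List.count_singleton] at h
    exact List.mem_reverse.2 (List.count_pos_iff.1 (by simpa using h))
  obtain ⟨c, a, hca, hc⟩ := List.eq_append_cons_of_mem hm
  obtain rfl : m = a.reverse ++ black :: c.reverse := by
    rw [← m.reverse_reverse, hca]
    simp
  have hc' : black ∉ c.reverse := by simpa using hc
  have htail : white :: c.reverse = c.reverse ++ [white] := by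
    rw [eq_replicate_white_of_black_notMem hc', ← List.replicate_succ, ← List.replicate_succ']
  have halive : AllAlive (black :: (a.reverse ++ white :: c.reverse)) := by
    rw [htail, ← List.append_assoc]
    exact allAlive_black_cons_append_white _
  refine ⟨black :: (a.reverse ++ white :: c.reverse),
    ⟨black :: a.reverse, c.reverse, [], by simp, hc', ?_⟩, List.cons_ne_nil _ _, ?_⟩
  · rw [← removeDead_of_allAlive halive, ← removeDead_append_black]
    simp
  · simp only [excess_append, excess_black_cons, excess_white_cons, excess_nil]
    ring

theorem IsStrip.exists_eq_black_cons_replicate (hs : IsStrip s) (h : s.count black ≤ 1) :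
    ∃ k, s = black :: List.replicate (k + 1) white := by
  obtain ⟨m, rfl⟩ := hs.2.eq_nil_or_eq.resolve_left hs.1
  have hm : black ∉ m := by simpa [List.count_eq_zero] using h
  refine ⟨m.length, ?_⟩
  rw [List.replicate_succ', ← eq_replicate_white_of_black_notMem hm]

theorem move_true_nil_of_count_black_le_one (hs : IsStrip s) (h : s.count black ≤ 1) :
    Move true s [] := by
  obtain ⟨k, rfl⟩ := hs.exists_eq_black_cons_replicate h
  refine ⟨[], List.replicate k white, [], ?_, ?_, ?_⟩
  · simp [List.replicate_succ']
  · simp [ofPlayer, List.mem_replicate]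
  · rw [List.nil_append, removeDead_white_cons, removeDead_append_black]
    simp [removeDead]

theorem exists_move_true_of_count_black_le_one (hs : IsStrip s) (h : s.count black ≤ 1) :
    ∃ t, Move true s t ∧ (t = [] ∧ excess s = 0 ∨ t ≠ [] ∧ excess t = excess s - 1) := by
  obtain ⟨k, rfl⟩ := hs.exists_eq_black_cons_replicate h
  refine ⟨removeDead (black :: List.replicate k white),
    ⟨[], [], List.replicate k white, rfl, List.not_mem_nil, (removeDead_white_cons _).symm⟩, ?_⟩
  cases k with
  | zero => exact .inl ⟨rfl, rfl⟩
  | succ k =>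
    have halive : AllAlive (black :: List.replicate (k + 1) white) := by
      rw [List.replicate_succ']
      exact allAlive_black_cons_append_white _
    right
    rw [removeDead_of_allAlive halive]
    exact ⟨List.cons_ne_nil _ _, by simp [excess, List.count_replicate]⟩

/-- A row that is empty or a larva, provided that all of its stones are alive. -/
def IsLarvaOrNil (s : List Stone) : Prop := s.count black ≤ 1 ∨ s.count white ≤ 1

theorem IsLarva.isLarvaOrNil (h : IsLarva s) : IsLarvaOrNil s := by
  obtain ⟨k, -, rfl | rfl⟩ := h
  · left
    simp [List.count_replicate]
  · right
    simp [List.count_replicate]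

theorem IsLarvaOrNil.of_move (hs : IsLarvaOrNil s) (h : Move p s t) : IsLarvaOrNil t :=
  hs.imp (h.count_le black).trans (h.count_le white).trans

theorem inversions_eq_zero (h : black ∉ s ∨ white ∉ s) : inversions s = 0 := by
  induction s with
  | nil => rfl
  | cons x s ih => cases x <;> simp_all [inversions, List.count_eq_zero]

theorem IsLarvaOrNil.inversions_eq (hs : AllAlive s) (h : IsLarvaOrNil s) :
    inversions s = s.count black * s.count white := by
  obtain rfl | ⟨m, rfl⟩ := hs.eq_nil_or_eq
  · rfl
  · have hm : black ∉ m ∨ white ∉ m := by simpa [IsLarvaOrNil, List.count_eq_zero] using h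
    rcases hm with hm | hm <;>
      simp [inversions, inversions_append, inversions_eq_zero, hm, List.count_eq_zero.2 hm,
        add_comm]

theorem one_le_count (hs : IsStrip s) (x : Stone) : 1 ≤ s.count x := by
  obtain ⟨m, rfl⟩ := hs.2.eq_nil_or_eq.resolve_left hs.1
  cases x <;> simp

/-- On a larva the excess determines the number of inversions, which drops with every move. -/
theorem IsLarvaOrNil.excess_ne_of_move (hs : AllAlive s) (h : IsLarvaOrNil s) (hst : Move p s t)
    (ht : t ≠ []) : excess t ≠ excess s := by
  intro heq
  have hlt := hst.inversions_lt
  rw [h.inversions_eq hs, (h.of_move hst).inversions_eq hst.allAlive] at hlt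
  have hb := one_le_count ⟨ht, hst.allAlive⟩ black
  have hw := one_le_count ⟨ht, hst.allAlive⟩ white
  have hb' := hst.count_le black
  have hw' := hst.count_le white
  unfold excess at heq
  rcases h with h | h
  · have h1 : s.count black = t.count black := by omega
    have h2 : s.count white = t.count white := by omega
    simp [h1, h2] at hlt
  · have h2 : s.count white = t.count white := by omega
    have h1 : s.count black = t.count black := by omega
    simp [h1, h2] at hlt

/-! ### The winning criterion for sums -/

variable {A B S T : List (List Stone)} {k : ℤ}

theorem Move.ne_nil (h : Move p s t) : s ≠ [] := by
  obtain ⟨u, m, v, rfl, -, -⟩ := h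
  simp

/-- The number of non-empty rows: a row stays in the list after its last stone has died. -/
def stripCount (S : List (List Stone)) : ℕ := S.countP (· ≠ [])

theorem stripCount_of_forall_ne_nil (hS : ∀ s ∈ S, s ≠ []) : stripCount S = S.length :=
  List.countP_eq_length.2 (by simpa using hS)

theorem stripCount_nil_middle : stripCount (A ++ [] :: B) = stripCount (A ++ B) := by
  simp [stripCount]

theorem stripCount_middle (hs : s ≠ []) :
    stripCount (A ++ s :: B) = stripCount (A ++ B) + 1 := by
  simp [stripCount, hs, add_assoc]

theorem totalExcess_middle : totalExcess (A ++ s :: B) = totalExcess (A ++ B) + excess s := by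
  simp only [totalExcess, List.map_append, List.map_cons, List.sum_append, List.sum_cons]
  ring

theorem forall_mem_middle_of_replace {P : List Stone → Prop} (h : ∀ r ∈ A ++ s :: B, P r)
    (ht : P t) : ∀ r ∈ A ++ t :: B, P r := by
  simp only [List.forall_mem_append, List.forall_mem_cons] at h ⊢
  exact ⟨h.1, ht, h.2.2⟩

/-- The criterion by which Left wins a sum of rows, moving first if `k = 0` and moving second if
`k = 1` (see `leftWins_sumGame`). -/
def LeftAhead (k : ℤ) (S : List (List Stone)) : Prop :=
  k < totalExcess S ∨
    (totalExcess S = k ∧ Odd (stripCount S)) ∨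
      (totalExcess S = k - 1 ∧ Even (stripCount S) ∧ ∀ s ∈ S, IsLarvaOrNil s)

theorem LeftAhead.of_move_false (h : LeftAhead 1 (A ++ s :: B)) (hs : AllAlive s)
    (hst : Move false s t) : LeftAhead 0 (A ++ t :: B) := by
  have hlarva (hL : ∀ r ∈ A ++ s :: B, IsLarvaOrNil r) : ∀ r ∈ A ++ t :: B, IsLarvaOrNil r :=
    forall_mem_middle_of_replace hL (.of_move (hL s (by simp)) hst)
  unfold LeftAhead at h ⊢
  simp only [totalExcess_middle, stripCount_middle hst.ne_nil, Nat.odd_iff, Nat.even_iff] at h ⊢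
  by_cases ht : t = []
  · subst ht
    have hexcess := excess_nonpos_of_move_false_nil hs hst
    rw [stripCount_nil_middle, excess_nil]
    omega
  · have hexcess := excess_sub_one_le_of_move_false hs hst
    rw [stripCount_middle ht]
    rcases h with h | ⟨h, hodd⟩ | ⟨h, heven, hL⟩
    · omega
    · omega
    · have hne := (hL s (by simp)).excess_ne_of_move hs hst ht
      have hL' := hlarva hL
      by_cases hlt : excess s < excess t
      · omega
      · exact .inr (.inr ⟨by omega, heven, hL'⟩)

theorem LeftAhead.exists_move_true_of_two_le_count_black (h : LeftAhead 0 (A ++ s :: B))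
    (hs : AllAlive s) (hblack : 2 ≤ s.count black) :
    ∃ t, Move true s t ∧ LeftAhead 1 (A ++ t :: B) := by
  obtain ⟨t, hst, ht, hexcess⟩ := Bipass.exists_move_true_of_two_le_count_black hs hblack
  refine ⟨t, hst, ?_⟩
  unfold LeftAhead at h ⊢
  rw [totalExcess_middle, stripCount_middle hst.ne_nil] at h
  rw [totalExcess_middle, stripCount_middle ht, hexcess]
  rcases h with h | ⟨h, hodd⟩ | ⟨h, heven, hL⟩
  · exact .inl (by omega)
  · exact .inr (.inl ⟨by omega, hodd⟩)
  · exact .inr (.inr ⟨by omega, heven,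
      forall_mem_middle_of_replace hL (.of_move (hL s (by simp)) hst)⟩)

theorem mul_stripCount_le_totalExcess (h : ∀ s ∈ S, s ≠ [] → k ≤ excess s) :
    k * stripCount S ≤ totalExcess S := by
  induction S with
  | nil => simp [stripCount, totalExcess]
  | cons s S ih =>
    rw [List.forall_mem_cons] at h
    have ih := ih h.2
    by_cases hs : s = []
    · subst hs
      simpa [stripCount, totalExcess, excess_nil] using ih
    · simp only [stripCount, totalExcess, List.map_cons, List.sum_cons, ne_eq, hs,
        not_false_eq_true, decide_true, List.countP_cons_of_pos, Nat.cast_succ] at ih ⊢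
      linarith [h.1 hs]

theorem totalExcess_nonpos (h : ∀ s ∈ S, s ≠ [] → excess s ≤ 0) : totalExcess S ≤ 0 := by
  have hle := List.sum_le_card_nsmul (S.map excess) 0 <| by
    intro x hx
    obtain ⟨s, hsS, rfl⟩ := List.mem_map.1 hx
    obtain rfl | hs := eq_or_ne s []
    · exact le_rfl
    · exact h s hsS hs
  rwa [nsmul_zero] at hle

section SingleBlack

variable (hS : ∀ s ∈ S, AllAlive s ∧ s.count black ≤ 1)

include hS

theorem totalExcess_nonneg_of_count_black_le_one : 0 ≤ totalExcess S := by
  simpa using mul_stripCount_le_totalExcess (k := 0) fun s hs _ =>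
    excess_nonneg_of_count_black_le_one (hS s hs).1 (hS s hs).2

theorem leftAhead_one_of_count_black_le_one
    (h : 2 ≤ totalExcess S ∨ Even (totalExcess S + stripCount S)) : LeftAhead 1 S := by
  have hΔ := totalExcess_nonneg_of_count_black_le_one hS
  have hL : ∀ s ∈ S, IsLarvaOrNil s := fun s hs => .inl (hS s hs).2
  simp only [LeftAhead, iff_true_intro hL, and_true, Int.even_iff, Nat.even_iff,
    Nat.odd_iff] at h ⊢
  omega

theorem exists_move_true_of_three_le_or_odd (hpos : 0 < stripCount S)
    (h : 3 ≤ totalExcess S ∨ Odd (totalExcess S + stripCount S)) :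
    ∃ A s B t, S = A ++ s :: B ∧ Move true s t ∧ LeftAhead 1 (A ++ t :: B) := by
  obtain ⟨s, hsS, hs⟩ := List.countP_pos_iff.1 hpos
  obtain ⟨A, B, rfl⟩ := List.append_of_mem hsS
  obtain ⟨halive, hblack⟩ := hS s hsS
  obtain ⟨t, hst, ht⟩ :=
    exists_move_true_of_count_black_le_one ⟨of_decide_eq_true hs, halive⟩ hblack
  refine ⟨A, s, B, t, rfl, hst, leftAhead_one_of_count_black_le_one
    (forall_mem_middle_of_replace hS ⟨hst.allAlive, (hst.count_le black).trans hblack⟩) ?_⟩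
  rw [totalExcess_middle, stripCount_middle hst.ne_nil] at h
  rw [totalExcess_middle]
  obtain ⟨rfl, hexcess⟩ | ⟨ht, hexcess⟩ := ht
  · rw [stripCount_nil_middle, excess_nil]
    simp only [Int.even_iff, Int.odd_iff] at h ⊢
    omega
  · rw [stripCount_middle ht]
    simp only [Int.even_iff, Int.odd_iff] at h ⊢
    omega

theorem exists_move_true_of_even (hpos : 0 < stripCount S)
    (hΔ : totalExcess S = 1 ∨ totalExcess S = 2)
    (heven : Even (totalExcess S + stripCount S)) :
    ∃ A s B t, S = A ++ s :: B ∧ Move true s t ∧ LeftAhead 1 (A ++ t :: B) := by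
  obtain ⟨s, hsS, hs, hexcess⟩ :
      ∃ s ∈ S, s ≠ [] ∧ (totalExcess S = 1 ∧ 1 ≤ excess s ∨ totalExcess S = 2 ∧ excess s ≤ 1) := by
    by_contra! hnone
    obtain hΔ | hΔ := hΔ
    · have hle := totalExcess_nonpos fun s hsS hs =>
        Int.le_of_lt_add_one ((hnone s hsS hs).1 hΔ)
      omega
    · have hn := mul_stripCount_le_totalExcess (k := 2) fun s hsS hs => (hnone s hsS hs).2 hΔ
      rw [Int.even_iff] at heven
      omega
  obtain ⟨A, B, rfl⟩ := List.append_of_mem hsS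
  obtain ⟨halive, hblack⟩ := hS s hsS
  refine ⟨A, s, B, [], rfl, move_true_nil_of_count_black_le_one ⟨hs, halive⟩ hblack,
    leftAhead_one_of_count_black_le_one
      (forall_mem_middle_of_replace hS ⟨allAlive_nil, by simp⟩) ?_⟩
  have hrest : 0 ≤ totalExcess (A ++ B) :=
    totalExcess_nonneg_of_count_black_le_one fun r hr =>
      hS r (List.mem_append.2 ((List.mem_append.1 hr).imp_right (List.mem_cons_of_mem s)))
  have hnonneg := excess_nonneg_of_count_black_le_one halive hblack
  rw [totalExcess_middle] at hexcess
  rw [totalExcess_middle, stripCount_middle hs] at heven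
  rw [totalExcess_middle, stripCount_nil_middle, excess_nil]
  simp only [Int.even_iff] at heven ⊢
  omega

end SingleBlack

theorem LeftAhead.stripCount_pos (h : LeftAhead 0 S) (hΔ : 0 ≤ totalExcess S) :
    0 < stripCount S := by
  by_contra! h0
  have hnil : ∀ s ∈ S, s = [] := by
    simpa [stripCount] using h0
  have hle := totalExcess_nonpos fun s hsS hs => absurd (hnil s hsS) hs
  simp only [LeftAhead, Nat.odd_iff] at h
  omega

theorem LeftAhead.exists_move_true (h : LeftAhead 0 S) (hS : ∀ s ∈ S, AllAlive s) :
    ∃ A s B t, S = A ++ s :: B ∧ Move true s t ∧ LeftAhead 1 (A ++ t :: B) := by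
  by_cases hblack : ∀ s ∈ S, s.count black ≤ 1
  · have hS' : ∀ s ∈ S, AllAlive s ∧ s.count black ≤ 1 := fun s hs => ⟨hS s hs, hblack s hs⟩
    have hΔ := totalExcess_nonneg_of_count_black_le_one hS'
    have hpos := h.stripCount_pos hΔ
    by_cases hodd : 3 ≤ totalExcess S ∨ Odd (totalExcess S + stripCount S)
    · exact exists_move_true_of_three_le_or_odd hS' hpos hodd
    · rw [not_or, Int.not_odd_iff_even] at hodd
      refine exists_move_true_of_even hS' hpos ?_ hodd.2
      obtain ⟨hlt, heven⟩ := hodd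
      rcases h with h | ⟨h, hn⟩ | h
      · omega
      · rw [h, zero_add, Int.even_coe_nat] at heven
        exact absurd heven (Nat.not_even_iff_odd.2 hn)
      · omega
  · push Not at hblack
    obtain ⟨s, hs, h2⟩ := hblack
    obtain ⟨A, B, rfl⟩ := List.append_of_mem hs
    obtain ⟨t, hst, ht⟩ := h.exists_move_true_of_two_le_count_black (hS s hs) h2
    exact ⟨A, s, B, t, rfl, hst, ht⟩

theorem leftWins_sumGame (hS : ∀ s ∈ S, AllAlive s) :
    (LeftAhead 0 S → LeftWins true (sumGame S)) ∧
      (LeftAhead 1 S → LeftWins false (sumGame S)) := by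
  induction hG : sumGame S using option_induction generalizing S with
  | h G ih =>
    subst hG
    constructor <;> intro h
    · obtain ⟨A, s, B, t, rfl, hst, ht⟩ := h.exists_move_true hS
      have hoption := isOption_sumGame.2 ⟨A, s, B, t, rfl, hst, rfl⟩
      exact leftWins_true_iff.2 ⟨_, hoption,
        (ih _ _ hoption (forall_mem_middle_of_replace hS hst.allAlive) rfl).2 ht⟩
    · refine leftWins_false_iff.2 fun K hK => ?_
      obtain ⟨A, s, B, t, rfl, hst, rfl⟩ := isOption_sumGame.1 hK
      exact (ih _ _ hK (forall_mem_middle_of_replace hS hst.allAlive) rfl).1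
        (h.of_move_false (hS s (by simp)) hst)

/-! ### Comparing balanced sums with small games -/

theorem value_sumGame (S : List (List Stone)) :
    value (sumGame S) = (S.map fun s => value (stripGame s)).sum := by
  induction S with
  | nil => rfl
  | cons s S ih =>
    rw [List.map_cons, List.sum_cons, ← ih]
    rfl

theorem value_sumGame_append (T S : List (List Stone)) :
    value (sumGame (T ++ S)) = value (sumGame T) + value (sumGame S) := by
  simp only [value_sumGame, List.map_append, List.sum_append]

theorem value_sumGame_map_mirror (S : List (List Stone)) :
    value (sumGame (S.map mirror)) = -value (sumGame S) := by
  simp [value_sumGame, List.sum_neg, Function.comp_def, value_stripGame_mirror]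

theorem le_sumGame_iff {G : Game} : G ≤ sumGame S ↔ sumGame (S.map mirror) ≤ -G := by
  rw [← value_le_value, ← value_le_value, value_sumGame_map_mirror, value_neg, neg_le_neg_iff]

theorem sumGame_lt_iff {G : Game} : sumGame S < G ↔ -G < sumGame (S.map mirror) := by
  rw [← value_lt_value, ← value_lt_value, value_sumGame_map_mirror, value_neg, neg_lt_neg_iff]

theorem equivalent_star_of_odd (hodd : Odd S.length)
    (hS : ∀ s ∈ S, Equivalent (stripGame s) star) : Equivalent (sumGame S) star := by
  obtain ⟨n, hn⟩ := hodd
  rw [← value_eq_value, value_sumGame, List.sum_eq_card_nsmul _ (value star)]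
  · rw [List.length_map, hn, succ_nsmul, mul_comm, mul_nsmul', two_nsmul,
      value_star_add_value_star, nsmul_zero, zero_add]
  · intro x hx
    obtain ⟨s, hs, rfl⟩ := List.mem_map.1 hx
    exact value_eq_value.2 (hS s hs)

theorem move_black_cons (hs : black ∉ s) :
    Move p (black :: s) t ↔
      ∃ m v, s = m ++ white :: v ∧ ofPlayer p ∉ m ∧ t = removeDead (m ++ black :: v) := by
  constructor
  · rintro ⟨_ | ⟨x, u⟩, m, v, h, hm, rfl⟩
    · exact ⟨m, v, (List.cons.inj h).2, hm, removeDead_white_cons _⟩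
    · rw [List.cons_append, List.cons.injEq] at h
      simp [h.2] at hs
  · rintro ⟨m, v, rfl, hm, rfl⟩
    exact ⟨[], m, v, rfl, hm, (removeDead_white_cons _).symm⟩

theorem move_black_white : Move p [black, white] t ↔ t = [] := by
  rw [move_black_cons (by simp)]
  simp [List.cons_eq_append_iff, show removeDead [black] = [] from rfl]

theorem move_true_black_white_white :
    Move true [black, white, white] t ↔ t = [black, white] ∨ t = [] := by
  rw [move_black_cons (by simp)]
  simp [List.cons_eq_append_iff, or_and_right, exists_or, ofPlayer,
    show removeDead [black, white] = [black, white] from rfl,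
    show removeDead [white, black] = [] from rfl]

theorem move_false_black_white_white :
    Move false [black, white, white] t ↔ t = [black, white] := by
  rw [move_black_cons (by simp)]
  simp [List.cons_eq_append_iff, or_and_right, exists_or, ofPlayer,
    show removeDead [black, white] = [black, white] from rfl]

theorem stripGame_nil_equivalent : Equivalent (stripGame []) 0 := by
  have h (p : Bool) (K : Game) : ¬ IsOption p (stripGame []) K := by
    rw [isOption_stripGame]
    rintro ⟨t, ht, -⟩
    exact ht.ne_nil rfl
  exact
    ⟨le_of_forall_option_le (fun K hK => absurd hK (h _ _)) fun K hK => absurd hK not_isOption_zero,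
     le_of_forall_option_le (fun K hK => absurd hK not_isOption_zero) fun K hK => absurd hK (h _ _)⟩

theorem stripGame_black_white_equivalent : Equivalent (stripGame [black, white]) star := by
  have h (p : Bool) (K : Game) : IsOption p (stripGame [black, white]) K ↔ stripGame [] = K := by
    simp [isOption_stripGame, move_black_white]
  have hstar (p : Bool) (K : Game) : IsOption p star K ↔ 0 = K := by
    simp only [Game.star, isOption_ofOptions, ite_self]
  have hnil := stripGame_nil_equivalent
  constructor <;> refine le_of_forall_option_le ?_ ?_ <;>
    simp only [h, hstar, forall_eq', exists_eq_left']
  exacts [hnil.1, hnil.1, hnil.2, hnil.2]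

theorem stripGame_black_white_white_equivalent :
    Equivalent (stripGame [black, white, white]) up := by
  have hL (K : Game) : IsOption true (stripGame [black, white, white]) K ↔
      stripGame [black, white] = K ∨ stripGame [] = K := by
    simp [isOption_stripGame, move_true_black_white_white]
  have hR (K : Game) : IsOption false (stripGame [black, white, white]) K ↔
      stripGame [black, white] = K := by
    simp [isOption_stripGame, move_false_black_white_white]
  have hupL : IsOption true up 0 := isOption_ofOptions.2 rfl
  have hupR (K : Game) : IsOption false up K ↔ star = K := isOption_ofOptions
  have hstarR : IsOption false star 0 := isOption_ofOptions.2 rfl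
  have hstar := stripGame_black_white_equivalent
  have hnil := stripGame_nil_equivalent
  have up_nonneg : 0 ≤ up := by
    refine le_iff_forall_not_le.2 ⟨fun K hK => absurd hK not_isOption_zero, ?_⟩
    simp only [hupR, forall_eq']
    exact (isOption_ofOptions.2 rfl : IsOption true star 0).not_le
  constructor
  · refine le_iff_forall_not_le.2 ⟨?_, ?_⟩
    · intro K hK h
      obtain rfl | rfl := (hL K).1 hK
      · exact hstarR.not_ge (up_nonneg.trans (h.trans hstar.1))
      · exact hupL.not_le (h.trans hnil.1)
    · simp only [hupR, forall_eq']
      exact fun h => ((hR _).2 rfl).not_ge (hstar.1.trans h)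
  · refine le_of_forall_option_le ?_ ?_
    · simp only [up, isOption_ofOptions, if_true, forall_eq']
      exact ⟨_, (hL _).2 (.inr rfl), hnil.2⟩
    · simp only [hR, forall_eq']
      exact ⟨star, (hupR _).2 rfl, hstar.2⟩

theorem isStrip_black_white : IsStrip [black, white] :=
  ⟨List.cons_ne_nil _ _, allAlive_black_cons_append_white []⟩

theorem isStrip_black_white_white : IsStrip [black, white, white] :=
  ⟨List.cons_ne_nil _ _, allAlive_black_cons_append_white [white]⟩

theorem sumGame_black_white_equivalent : Equivalent (sumGame [[black, white]]) star := by
  simpa [← value_eq_value, value_sumGame] using stripGame_black_white_equivalent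

theorem sumGame_black_white_white_equivalent :
    Equivalent (sumGame [[black, white, white]]) up := by
  simpa [← value_eq_value, value_sumGame] using stripGame_black_white_white_equivalent

theorem sumGame_upStar_equivalent :
    Equivalent (sumGame [[black, white, white], [black, white]]) upStar := by
  rw [← value_eq_value, value_sumGame, upStar, value_add,
    ← value_eq_value.2 stripGame_black_white_white_equivalent,
    ← value_eq_value.2 stripGame_black_white_equivalent]
  simp

theorem leftWins_sumGame_true (hS : ∀ s ∈ S, IsStrip s)
    (h : 0 < totalExcess S ∨ totalExcess S = 0 ∧ Odd S.length) : LeftWins true (sumGame S) := by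
  refine (leftWins_sumGame fun s hs => (hS s hs).2).1 ?_
  rw [LeftAhead, stripCount_of_forall_ne_nil fun s hs => (hS s hs).1]
  exact h.imp_right .inl

theorem leftWins_sumGame_false (hS : ∀ s ∈ S, IsStrip s)
    (h : 1 < totalExcess S ∨ totalExcess S = 1 ∧ Odd S.length) : LeftWins false (sumGame S) := by
  refine (leftWins_sumGame fun s hs => (hS s hs).2).2 ?_
  rw [LeftAhead, stripCount_of_forall_ne_nil fun s hs => (hS s hs).1]
  exact h.imp_right .inl

theorem totalExcess_append (S T : List (List Stone)) :
    totalExcess (S ++ T) = totalExcess S + totalExcess T := by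
  simp only [totalExcess, List.map_append, List.sum_append]

theorem totalExcess_map_mirror (S : List (List Stone)) :
    totalExcess (S.map mirror) = -totalExcess S := by
  simp [totalExcess, List.sum_neg, Function.comp_def, excess_mirror]

theorem IsStrip.mirror (hs : IsStrip s) : IsStrip (mirror s) :=
  ⟨by simpa [Bipass.mirror] using hs.1, hs.2.mirror⟩

/-- A sum of strips with as many white stones as black ones. -/
structure IsBalanced (S : List (List Stone)) : Prop where
  isStrip : ∀ s ∈ S, IsStrip s
  totalExcess_eq_zero : totalExcess S = 0

theorem IsBalanced.map_mirror (hS : IsBalanced S) : IsBalanced (S.map mirror) where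
  isStrip := List.forall_mem_map.2 fun s hs => (hS.isStrip s hs).mirror
  totalExcess_eq_zero := by rw [totalExcess_map_mirror, hS.totalExcess_eq_zero, neg_zero]

theorem IsLarvaOrNil.mirror (h : IsLarvaOrNil s) : IsLarvaOrNil (mirror s) :=
  h.symm.imp (count_swap_mirror s white).trans_le (count_swap_mirror s black).trans_le

namespace IsBalanced

variable {G : Game}

theorem not_le_neg (hS : IsBalanced S) (hT : ∀ s ∈ T, IsStrip s)
    (hG : Equivalent (sumGame T) G)
    (h : 0 < totalExcess T ∨ totalExcess T = 0 ∧ Odd (T.length + S.length)) :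
    ¬ sumGame S ≤ -G := by
  rw [← value_le_value, value_neg, ← value_eq_value.2 hG, ← sub_nonpos, sub_neg_eq_add, add_comm,
    ← value_sumGame_append, ← value_zero, value_le_value, not_le_zero_iff_leftWins_true]
  refine leftWins_sumGame_true (List.forall_mem_append.2 ⟨hT, hS.isStrip⟩) ?_
  rwa [totalExcess_append, hS.totalExcess_eq_zero, add_zero, List.length_append]

theorem neg_lt (hS : IsBalanced S) (hT : ∀ s ∈ T, IsStrip s)
    (hG : Equivalent (sumGame T) G)
    (h : 1 < totalExcess T ∨ totalExcess T = 1 ∧ Odd (T.length + S.length)) :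
    -G < sumGame S := by
  refine lt_of_le_not_ge ?_ (hS.not_le_neg hT hG (by omega))
  rw [← value_le_value, value_neg, ← value_eq_value.2 hG, ← sub_nonneg, sub_neg_eq_add, add_comm,
    ← value_sumGame_append, ← value_zero, value_le_value, zero_le_iff_leftWins_false]
  refine leftWins_sumGame_false (List.forall_mem_append.2 ⟨hT, hS.isStrip⟩) ?_
  rwa [totalExcess_append, hS.totalExcess_eq_zero, add_zero, List.length_append]

theorem not_le_neg_and_not_ge (hS : IsBalanced S) (hT : ∀ s ∈ T, IsStrip s)
    (hG : Equivalent (sumGame T) G)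
    (h : 0 < totalExcess T ∨ totalExcess T = 0 ∧ Odd (T.length + S.length)) :
    ¬ sumGame S ≤ -G ∧ ¬ G ≤ sumGame S := by
  refine ⟨hS.not_le_neg hT hG h, ?_⟩
  rw [le_sumGame_iff]
  exact hS.map_mirror.not_le_neg hT hG (by rwa [List.length_map])

theorem neg_lt_and_lt (hS : IsBalanced S) (hT : ∀ s ∈ T, IsStrip s)
    (hG : Equivalent (sumGame T) G)
    (h : 1 < totalExcess T ∨ totalExcess T = 1 ∧ Odd (T.length + S.length)) :
    -G < sumGame S ∧ sumGame S < G := by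
  refine ⟨hS.neg_lt hT hG h, ?_⟩
  rw [sumGame_lt_iff]
  exact hS.map_mirror.neg_lt hT hG (by rwa [List.length_map])

theorem fuzzy_zero (hS : IsBalanced S) (hodd : Odd S.length) : Fuzzy (sumGame S) 0 := by
  have h := hS.not_le_neg_and_not_ge (T := []) (G := 0) (List.forall_mem_nil _) ⟨le_rfl, le_rfl⟩
    (.inr ⟨rfl, by simpa using hodd⟩)
  rwa [Game.neg_zero] at h

theorem fuzzy_star (hS : IsBalanced S) (heven : Even S.length) : Fuzzy (sumGame S) star := by
  have h := hS.not_le_neg_and_not_ge (T := [[black, white]]) (by simpa using isStrip_black_white)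
    sumGame_black_white_equivalent (.inr ⟨rfl, heven.one_add⟩)
  rwa [neg_star] at h

theorem down_lt_and_lt_up (hS : IsBalanced S) (heven : Even S.length) :
    down < sumGame S ∧ sumGame S < up := by
  rw [← neg_up]
  exact hS.neg_lt_and_lt (T := [[black, white, white]])
    (by simpa using isStrip_black_white_white)
    sumGame_black_white_white_equivalent (.inr ⟨rfl, heven.one_add⟩)

theorem downStar_lt_and_lt_upStar (hS : IsBalanced S) (hodd : Odd S.length) :
    downStar < sumGame S ∧ sumGame S < upStar := by
  rw [← neg_upStar]
  exact hS.neg_lt_and_lt (T := [[black, white, white], [black, white]])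
    (by simpa using ⟨isStrip_black_white_white, isStrip_black_white⟩)
    sumGame_upStar_equivalent (.inr ⟨rfl, even_two.add_odd hodd⟩)

theorem lessOrFuzzy_down_and_up (hS : IsBalanced S) :
    LessOrFuzzy down (sumGame S) ∧ LessOrFuzzy (sumGame S) up := by
  rw [lessOrFuzzy_iff, lessOrFuzzy_iff, ← neg_up]
  exact hS.not_le_neg_and_not_ge (T := [[black, white, white]])
    (by simpa using isStrip_black_white_white) sumGame_black_white_white_equivalent (.inl one_pos)

theorem lessOrFuzzy_downStar_and_upStar (hS : IsBalanced S) :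
    LessOrFuzzy downStar (sumGame S) ∧ LessOrFuzzy (sumGame S) upStar := by
  rw [lessOrFuzzy_iff, lessOrFuzzy_iff, ← neg_upStar]
  exact hS.not_le_neg_and_not_ge (T := [[black, white, white], [black, white]])
    (by simpa using ⟨isStrip_black_white_white, isStrip_black_white⟩)
    sumGame_upStar_equivalent (.inl one_pos)

theorem nonneg_of_isLarvaOrNil (hS : IsBalanced S) (heven : Even S.length)
    (hL : ∀ s ∈ S, IsLarvaOrNil s) : 0 ≤ sumGame S := by
  refine zero_le_iff_leftWins_false.2 ((leftWins_sumGame fun s hs => (hS.isStrip s hs).2).2 ?_)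
  rw [LeftAhead, stripCount_of_forall_ne_nil fun s hs => (hS.isStrip s hs).1]
  exact .inr (.inr ⟨hS.totalExcess_eq_zero, heven, hL⟩)

theorem equivalent_zero_of_isLarvaOrNil (hS : IsBalanced S) (heven : Even S.length)
    (hL : ∀ s ∈ S, IsLarvaOrNil s) : Equivalent (sumGame S) 0 := by
  refine ⟨?_, hS.nonneg_of_isLarvaOrNil heven hL⟩
  have h := hS.map_mirror.nonneg_of_isLarvaOrNil (by rwa [List.length_map])
    (List.forall_mem_map.2 fun s hs => (hL s hs).mirror)
  rwa [← value_le_value, value_sumGame_map_mirror, value_zero, neg_nonneg] at h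

end IsBalanced

end Bipass

theorem mainTheorem4 (S : List (List Stone)) (hS : ∀ s ∈ S, IsStrip s)
    (hΔ : totalExcess S = 0) :
    (Odd S.length →
      Game.Fuzzy (sumGame S) 0 ∧
      ((∀ s ∈ S, Game.Equivalent (stripGame s) Game.star) → Game.Equivalent (sumGame S) Game.star) ∧
      (Game.downStar < sumGame S ∧ sumGame S < Game.upStar) ∧
      (Game.LessOrFuzzy Game.down (sumGame S) ∧ Game.LessOrFuzzy (sumGame S) Game.up)) ∧
    (Even S.length →
      Game.Fuzzy (sumGame S) Game.star ∧
      ((∀ s ∈ S, IsLarva s) → Game.Equivalent (sumGame S) 0) ∧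
      (Game.down < sumGame S ∧ sumGame S < Game.up) ∧
      (Game.LessOrFuzzy Game.downStar (sumGame S) ∧ Game.LessOrFuzzy (sumGame S) Game.upStar)) := by
  have hbal : IsBalanced S := ⟨hS, hΔ⟩
  refine ⟨fun hodd => ⟨hbal.fuzzy_zero hodd, equivalent_star_of_odd hodd,
    hbal.downStar_lt_and_lt_upStar hodd, hbal.lessOrFuzzy_down_and_up⟩, fun heven =>
    ⟨hbal.fuzzy_star heven, fun hL => ?_, hbal.down_lt_and_lt_up heven,
    hbal.lessOrFuzzy_downStar_and_upStar⟩⟩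
  exact hbal.equivalent_zero_of_isLarvaOrNil heven fun s hs => (hL s hs).isLarvaOrNil
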